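/- Let $n, r$ be nonnegative integers with $r \ge n$. Let $\mathrm{Sym}^2(\mathbb{R}^n)$ be the real vector space of symmetric $n\times n$ matrices, and let $$\tau_r:\mathbb{R}^r\times(\mathbb{R}^n)^r\to \mathrm{Sym}^2(\mathbb{R}^n),\qquad \tau_r(\alpha,w_1,\dots,w_r)=\sum_{i=1}^r \alpha_i\, w_i w_i^{\top},$$ so that $\tau_r(\alpha,w_1,\dots,w_r)$ is the matrix of the quadratic form $x\mapsto\sum_{i=1}^r\alpha_i (w_i\cdot x)^2$ computed by the shallow network of width $r$ with quadratic activation ($d=2$) and weights $(\alpha,w_1,\dots,w_r)$. Let $\ell:\mathrm{Sym}^2(\mathbb{R}^n)\to\mathbb{R}$ be a smooth ($C^\infty$) convex function. Then the function $L=\ell\circ\tau_r$ has no spurious valleys: $L$ is continuous and, for every $t\in\mathbb{R}$, the images under $L$ of all connected components of the sublevel set $\{\mathcal{W}\in\mathbb{R}^r\times(\mathbb{R}^n)^r : L(\mathcal{W})\le t\}$ are one and the same interval of $\mathbb{R}$. -/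

import Mathlib

open scoped ContDiff

-- The Frobenius norm on matrices; smoothness on a finite-dimensional space
-- does not depend on the choice of the norm.
attribute [local instance] Matrix.frobeniusNormedAddCommGroup Matrix.frobeniusNormedSpace

/-- `Sym²(ℝⁿ)`: the real vector space of symmetric `n × n` matrices, as a subspace of all
`n × n` matrices. -/
def SymSquare (n : ℕ) : Submodule ℝ (Matrix (Fin n) (Fin n) ℝ) where
  carrier := {A | A.IsSymm}
  add_mem' := fun hA hB => Matrix.IsSymm.add hA hB
  zero_mem' := Matrix.isSymm_zero
  smul_mem' := fun c _ hA => Matrix.IsSymm.smul hA c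

/-- The tensor square `w ⊗ w = w wᵀ` of a vector, as a symmetric matrix. -/
def tensorSquare {n : ℕ} (w : Fin n → ℝ) : SymSquare n :=
  ⟨Matrix.vecMulVec w w, Matrix.ext fun i j => mul_comm (w j) (w i)⟩

/-- The weights `(α, w₁, …, w_r) ∈ ℝʳ × (ℝⁿ)ʳ` of a shallow network of width `r` with `n` inputs
and scalar output. -/
abbrev NetworkWeights (r n : ℕ) : Type := (Fin r → ℝ) × (Fin r → Fin n → ℝ)

/-- The parameterization map `(α, w₁, …, w_r) ↦ ∑ i, αᵢ (wᵢ ⊗ wᵢ)` of shallow networks with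
quadratic activation. -/
noncomputable def quadraticNetworkMap (r n : ℕ) (W : NetworkWeights r n) : SymSquare n :=
  ∑ i, W.1 i • tensorSquare (W.2 i)

/-- A function `f` has no spurious valleys if it is continuous and, for every `t`, all connected
components of the sublevel set `{x | f x ≤ t}` have the same image under `f`, an interval of the
real line. The connected components are the sets `connectedComponentIn {x | f x ≤ t} x` with `x`
in the sublevel set. -/
def HasNoSpuriousValleys {X : Type*} [TopologicalSpace X] (f : X → ℝ) : Prop :=
  Continuous f ∧ ∀ t : ℝ, ∃ I : Set ℝ, I.OrdConnected ∧
    ∀ x ∈ {y | f y ≤ t}, f '' connectedComponentIn {y | f y ≤ t} x = I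

open Set Filter Topology

/-! Sublevel sets of `ℓ` are convex, but the network map has no global path lifting. It suffices to
lift rank-one segments `A + s c v vᵀ`, from any point of the fiber, up to reparameterization. Any
two points of a sublevel set are joined by a chain of such segments, so every component of the
sublevel set of `L` has the whole image of that of `ℓ` (`hasNoSpuriousValleys_comp_rankOneSum`).

Lifting (`exists_joinedIn_add_rankOne`): a unit with zero coefficient can be turned to `v` for free
and then switched on. If all coefficients are nonzero and the `wⱼ` are independent, `n ≤ r` makes
them a basis; completing squares carries the decomposition along until the end of the segment or
until a coefficient vanishes. If the `wⱼ` are dependent, the same device absorbs one term into the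
others inside the fiber, until a coefficient vanishes. -/

/-! ### Rank-one perturbations of diagonal forms -/

/-- The rank-one perturbation `∑ dⱼ wⱼ² + c v²`, with `v` in the span of the `wⱼ`, keeps a
decomposition with as many terms that depends continuously on `c`, as long as
`1 + c ∑ bⱼ² / dⱼ ≥ 0`; a coefficient vanishes when equality is reached. -/
theorem exists_rankOne_update {ι V E : Type*} [DecidableEq ι] [AddCommGroup V]
    [Module ℝ V] [TopologicalSpace V] [ContinuousAdd V] [ContinuousSMul ℝ V]
    [AddCommGroup E] [Module ℝ E] (B : V →ₗ[ℝ] V →ₗ[ℝ] E) (hB : ∀ x y, B x y = B y x)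
    (w : ι → V) (d b : ι → ℝ) (S : Finset ι) :
    ∀ C : ℝ, 0 ≤ C → (∀ j ∈ S, d j ≠ 0) → 0 ≤ 1 + C * ∑ j ∈ S, b j ^ 2 / d j →
    ∃ (α : ℝ → ι → ℝ) (u : ℝ → ι → V), ContinuousOn α (Icc 0 C) ∧ ContinuousOn u (Icc 0 C) ∧
      α 0 = d ∧ u 0 = w ∧
      (∀ c ∈ Icc 0 C, (∀ j ∉ S, α c j = d j ∧ u c j = w j) ∧
        ∑ j ∈ S, α c j • B (u c j) (u c j) = ∑ j ∈ S, d j • B (w j) (w j) +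
          c • B (∑ j ∈ S, b j • w j) (∑ j ∈ S, b j • w j)) ∧
      (1 + C * ∑ j ∈ S, b j ^ 2 / d j = 0 → ∃ j ∈ S, α C j = 0) := by
  induction S using Finset.strongInduction with
  | H S ih =>
  intro C hC hd hS
  rcases S.eq_empty_or_nonempty with rfl | hne
  · refine ⟨fun _ => d, fun _ => w, continuousOn_const, continuousOn_const, rfl, rfl, ?_, ?_⟩
    · simp
    · simp
  -- A nonnegative `d k` is preferred, so that `1 + C * (b k ^ 2 / d k) ≤ 0` can occur only when
  -- every `d j` is negative.
  obtain ⟨k, hk, hkneg⟩ : ∃ k ∈ S, d k < 0 → ∀ j ∈ S, d j < 0 := by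
    by_cases h : ∀ j ∈ S, d j < 0
    · obtain ⟨k, hk⟩ := hne
      exact ⟨k, hk, fun _ => h⟩
    · push Not at h
      obtain ⟨k, hk, hk'⟩ := h
      exact ⟨k, hk, fun h => absurd h hk'.not_gt⟩
  obtain ⟨T, hkT, rfl⟩ : ∃ T : Finset ι, k ∉ T ∧ S = insert k T :=
    ⟨S.erase k, Finset.notMem_erase k S, (Finset.insert_erase hk).symm⟩
  have hdk := hd k hk
  simp only [Finset.sum_insert hkT] at hS ⊢
  set v' := ∑ j ∈ T, b j • w j with hv'
  set σ := ∑ j ∈ T, b j ^ 2 / d j with hσ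
  by_cases hpos : 0 < 1 + C * (b k ^ 2 / d k)
  · have key : ∀ c ∈ Icc 0 C, 0 < 1 + c * (b k ^ 2 / d k) := by
      intro c hc
      rcases le_total 0 (b k ^ 2 / d k) with h | h
      · nlinarith [mul_nonneg hc.1 h]
      · nlinarith [mul_le_mul_of_nonpos_right hc.2 h]
    have hfac : ∀ c, d k + c * b k ^ 2 = d k * (1 + c * (b k ^ 2 / d k)) := by
      intro c; field_simp
    have hne0 : ∀ c ∈ Icc 0 C, d k + c * b k ^ 2 ≠ 0 := fun c hc => by
      rw [hfac]; exact mul_ne_zero hdk (key c hc).ne'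
    -- Completing the square in `w k` turns `d k • w_k² + c • (b k • w_k + v')²` into a square with
    -- coefficient `d k + c * b k ^ 2` plus `φ c • v'²`, to which induction on `T` applies.
    set φ : ℝ → ℝ := fun c => c / (1 + c * (b k ^ 2 / d k)) with hφ
    have hφc : ContinuousOn φ (Icc 0 C) :=
      continuousOn_id.div (by fun_prop) fun c hc => (key c hc).ne'
    have hφm : MapsTo φ (Icc 0 C) (Icc 0 (φ C)) := by
      intro c hc
      refine ⟨div_nonneg hc.1 (key c hc).le, ?_⟩
      rw [hφ]
      simp only
      rw [div_le_div_iff₀ (key c hc) hpos]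
      linarith [hc.2]
    have hφd : ∀ c ∈ Icc 0 C, φ c = c * d k / (d k + c * b k ^ 2) := by
      intro c hc
      have := hne0 c hc
      have := (key c hc).ne'
      simp only [hφ]
      rw [hfac, div_eq_div_iff this (by rw [← hfac]; assumption)]
      ring
    -- The quantity `1 + c ∑ bⱼ² / dⱼ`, the determinant ratio of the perturbed and original forms,
    -- is multiplicative under this elimination.
    have hφσ : 1 + φ C * σ = (1 + C * (b k ^ 2 / d k + σ)) / (1 + C * (b k ^ 2 / d k)) := by
      simp only [hφ]
      rw [eq_div_iff hpos.ne', add_mul, div_mul_eq_mul_div, div_mul_cancel₀ _ hpos.ne']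
      ring
    obtain ⟨α, u, hα, hu, hα0, hu0, hαu, hz⟩ := ih T
      (Finset.ssubset_insert hkT) (φ C)
      (div_nonneg hC hpos.le) (fun j hj => hd j (Finset.mem_insert_of_mem hj))
      (by rw [hφσ]; exact div_nonneg hS hpos.le)
    refine ⟨fun c => Function.update (α (φ c)) k (d k + c * b k ^ 2),
      fun c => Function.update (u (φ c)) k (w k + (c * b k / (d k + c * b k ^ 2)) • v'),
      ?_, ?_, ?_, ?_, ?_, ?_⟩
    · exact fun c hc => (hα.comp hφc hφm c hc).update k
        (by fun_prop : Continuous fun c => d k + c * b k ^ 2).continuousWithinAt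
    · have hcont : ContinuousOn (fun c => w k + (c * b k / (d k + c * b k ^ 2)) • v') (Icc 0 C) :=
        continuousOn_const.add <| ContinuousOn.smul
          (ContinuousOn.div (by fun_prop) (by fun_prop) hne0) continuousOn_const
      exact fun c hc => (hu.comp hφc hφm c hc).update k (hcont c hc)
    · have : φ 0 = 0 := by simp [hφ]
      simp [this, hα0]
    · have : φ 0 = 0 := by simp [hφ]
      simp [this, hu0]
    · intro c hc
      obtain ⟨h1, h2⟩ := hαu (φ c) (hφm hc)
      refine ⟨fun j hj => ?_, ?_⟩
      · rw [Finset.mem_insert, not_or] at hj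
        simpa [Function.update_of_ne hj.1] using h1 j hj.2
      · have h3 : ∑ j ∈ T, Function.update (α (φ c)) k (d k + c * b k ^ 2) j •
            B (Function.update (u (φ c)) k (w k + (c * b k / (d k + c * b k ^ 2)) • v') j)
              (Function.update (u (φ c)) k (w k + (c * b k / (d k + c * b k ^ 2)) • v') j) =
            ∑ j ∈ T, α (φ c) j • B (u (φ c) j) (u (φ c) j) := by
          refine Finset.sum_congr rfl fun j hj => ?_
          have : j ≠ k := fun h => hkT (h ▸ hj)
          simp [Function.update_of_ne this]
        beta_reduce
        rw [h3, h2, Function.update_self, Function.update_self, hφd c hc]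
        have := hne0 c hc
        simp only [map_add, map_smul, LinearMap.add_apply, LinearMap.smul_apply, smul_add,
          smul_smul, hB v' (w k)]
        match_scalars
        all_goals field_simp
        all_goals ring
    · intro h
      obtain ⟨j, hj, hj0⟩ := hz (by rw [hφσ, h, zero_div])
      refine ⟨j, Finset.mem_insert_of_mem hj, ?_⟩
      have : j ≠ k := fun h => hkT (h ▸ hj)
      simpa [Function.update_of_ne this] using hj0
  -- Borderline case: all terms of the sum are nonpositive, so `hS` forces those over `T` to vanish.
  -- Then `v' = 0` and only the `k`-th coefficient moves, reaching zero at `C`.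
  · have hdneg : d k < 0 := by
      rcases lt_or_gt_of_ne hdk with h | h
      · exact h
      · exact absurd (by positivity) hpos
    have hTneg : ∀ j ∈ T, b j ^ 2 / d j ≤ 0 := fun j hj =>
      div_nonpos_of_nonneg_of_nonpos (sq_nonneg _)
        (hkneg hdneg j (Finset.mem_insert_of_mem hj)).le
    have hCpos : 0 < C := by
      rcases hC.eq_or_lt with h | h
      · simp [← h] at hpos
      · exact h
    have hσ0 : σ = 0 := by
      have : σ ≤ 0 := Finset.sum_nonpos hTneg
      nlinarith
    have hb : ∀ j ∈ T, b j = 0 := by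
      intro j hj
      have := (Finset.sum_eq_zero_iff_of_nonpos hTneg).1 hσ0 j hj
      rcases div_eq_zero_iff.1 this with h | h
      · exact pow_eq_zero_iff (two_ne_zero) |>.1 h
      · exact absurd h (hd j (Finset.mem_insert_of_mem hj))
    have hv0 : v' = 0 := Finset.sum_eq_zero fun j hj => by rw [hb j hj, zero_smul]
    refine ⟨fun c => Function.update d k (d k + c * b k ^ 2), fun _ => w,
      (continuous_const.update k (by fun_prop)).continuousOn, continuousOn_const, ?_, rfl, ?_, ?_⟩
    · simp
    · intro c hc
      refine ⟨fun j hj => ?_, ?_⟩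
      · rw [Finset.mem_insert, not_or] at hj
        simp [Function.update_of_ne hj.1]
      · have h3 : ∑ j ∈ T, Function.update d k (d k + c * b k ^ 2) j • B (w j) (w j) =
            ∑ j ∈ T, d j • B (w j) (w j) := by
          refine Finset.sum_congr rfl fun j hj => ?_
          have : j ≠ k := fun h => hkT (h ▸ hj)
          simp [Function.update_of_ne this]
        beta_reduce
        rw [h3, Function.update_self, hv0]
        simp only [add_zero, map_smul, LinearMap.smul_apply, smul_smul]
        module
    · intro h
      refine ⟨k, Finset.mem_insert_self k T, ?_⟩
      beta_reduce
      rw [Function.update_self]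
      have : d k * (1 + C * (b k ^ 2 / d k + σ)) = 0 := by rw [h, mul_zero]
      rw [hσ0] at this
      field_simp at this
      linarith

/-- Either the whole rank-one perturbation `c v²` is reached, or some coefficient vanishes
before that. -/
theorem exists_unitInterval_rankOne_update {ι V E : Type*} [DecidableEq ι]
    [AddCommGroup V] [Module ℝ V] [TopologicalSpace V] [ContinuousAdd V] [ContinuousSMul ℝ V]
    [AddCommGroup E] [Module ℝ E] (B : V →ₗ[ℝ] V →ₗ[ℝ] E) (hB : ∀ x y, B x y = B y x)
    (w : ι → V) (d b : ι → ℝ) (S : Finset ι) (hd : ∀ j ∈ S, d j ≠ 0) (c : ℝ) :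
    ∃ θ ∈ Icc (0 : ℝ) 1, ∃ (α : ℝ → ι → ℝ) (u : ℝ → ι → V),
      ContinuousOn α (Icc 0 1) ∧ ContinuousOn u (Icc 0 1) ∧ α 0 = d ∧ u 0 = w ∧
      (∀ s ∈ Icc (0 : ℝ) 1, (∀ j ∉ S, α s j = d j ∧ u s j = w j) ∧
        ∑ j ∈ S, α s j • B (u s j) (u s j) = ∑ j ∈ S, d j • B (w j) (w j) +
          (s * θ * c) • B (∑ j ∈ S, b j • w j) (∑ j ∈ S, b j • w j)) ∧
      (θ = 1 ∨ ∃ j ∈ S, α 1 j = 0) := by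
  wlog hc : 0 < c generalizing c d
  · rcases (not_lt.1 hc).eq_or_lt with rfl | hc'
    · exact ⟨1, by simp, fun _ => d, fun _ => w, continuousOn_const, continuousOn_const, rfl, rfl,
        by simp, Or.inl rfl⟩
    · obtain ⟨θ, hθ, α, u, hα, hu, hα0, hu0, hαu, hz⟩ :=
        this (-d) (fun j hj => neg_ne_zero.2 (hd j hj)) (-c) (neg_pos.2 hc')
      refine ⟨θ, hθ, -α, u, hα.neg, hu, by simp [hα0], hu0, fun s hs => ⟨fun j hj => ?_, ?_⟩,
        hz.imp_right ?_⟩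
      · obtain ⟨h1, h2⟩ := (hαu s hs).1 j hj
        exact ⟨by simp [h1], h2⟩
      · have h2 := (hαu s hs).2
        simp only [Pi.neg_apply, neg_smul, Finset.sum_neg_distrib, mul_neg] at h2 ⊢
        rw [h2]
        abel
      · rintro ⟨j, hj, h⟩
        exact ⟨j, hj, by simp [h]⟩
  -- Stop at the first zero `s = -1 / (c * σ)` of `1 + s * c * σ` if it comes before `1`.
  obtain ⟨θ, hθ, hθS, hθz⟩ : ∃ θ ∈ Icc (0 : ℝ) 1, 0 ≤ 1 + θ * c * ∑ j ∈ S, b j ^ 2 / d j ∧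
      (θ = 1 ∨ 1 + θ * c * ∑ j ∈ S, b j ^ 2 / d j = 0) := by
    set σ := ∑ j ∈ S, b j ^ 2 / d j
    by_cases h : 0 ≤ 1 + c * σ
    · exact ⟨1, by simp, by simpa using h, Or.inl rfl⟩
    · have hcσ : c * σ < -1 := by linarith
      have h0 : 1 + -1 / (c * σ) * c * σ = 0 := by
        rw [mul_assoc, div_mul_cancel₀ _ (by linarith : c * σ < 0).ne]; norm_num
      refine ⟨-1 / (c * σ), ⟨div_nonneg_of_nonpos (by norm_num) (by linarith), ?_⟩, h0.ge, Or.inr h0⟩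
      rw [div_le_one_of_neg (by linarith)]
      exact hcσ.le
  obtain ⟨α, u, hα, hu, hα0, hu0, hαu, hz⟩ := exists_rankOne_update B hB w d b S (θ * c)
    (mul_nonneg hθ.1 hc.le) hd hθS
  have hm : MapsTo (fun s => s * (θ * c)) (Icc (0 : ℝ) 1) (Icc 0 (θ * c)) := fun s hs =>
    ⟨mul_nonneg hs.1 (mul_nonneg hθ.1 hc.le),
      mul_le_of_le_one_left (mul_nonneg hθ.1 hc.le) hs.2⟩
  refine ⟨θ, hθ, fun s => α (s * (θ * c)), fun s => u (s * (θ * c)),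
    hα.comp (by fun_prop) hm, hu.comp (by fun_prop) hm, by simp [hα0], by simp [hu0],
    fun s hs => ?_, hθz.imp_right fun h => by simpa using hz h⟩
  simpa [mul_assoc] using hαu _ (hm hs)

/-! ### Lifting rank-one segments -/

/-- The sum `∑ i, αᵢ B(wᵢ, wᵢ)`. -/
def rankOneSum {ι V E : Type*} [Fintype ι] [AddCommGroup V] [Module ℝ V] [AddCommGroup E]
    [Module ℝ E] (B : V →ₗ[ℝ] V →ₗ[ℝ] E) (W : (ι → ℝ) × (ι → V)) : E :=
  ∑ i, W.1 i • B (W.2 i) (W.2 i)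

theorem rankOneSum_update {ι V E : Type*} [Fintype ι] [DecidableEq ι] [AddCommGroup V]
    [Module ℝ V] [AddCommGroup E] [Module ℝ E] (B : V →ₗ[ℝ] V →ₗ[ℝ] E) (α : ι → ℝ) (u : ι → V)
    (i : ι) (a : ℝ) (x : V) :
    rankOneSum B (Function.update α i a, Function.update u i x) =
      rankOneSum B (α, u) - α i • B (u i) (u i) + a • B x x := by
  unfold rankOneSum
  rw [← Finset.add_sum_erase _ _ (Finset.mem_univ i), ← Finset.add_sum_erase (a := i)
    (f := fun j => α j • B (u j) (u j)) _ (Finset.mem_univ i)]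
  have : ∀ j ∈ Finset.univ.erase i, Function.update α i a j •
      B (Function.update u i x j) (Function.update u i x j) = α j • B (u j) (u j) := by
    intro j hj
    simp [Function.update_of_ne (Finset.ne_of_mem_erase hj)]
  simp only [Finset.sum_congr rfl this, Function.update_self]
  abel

theorem Convex.add_smul_mem_of_mem_Icc {E : Type*} [AddCommGroup E] [Module ℝ E] {K : Set E}
    (hK : Convex ℝ K) {x y : E} (hx : x ∈ K) (hxy : x + y ∈ K) {s : ℝ} (hs : s ∈ Icc (0 : ℝ) 1) :
    x + s • y ∈ K := by
  simpa using hK.add_smul_sub_mem hx hxy hs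

section Lift

variable {ι V E : Type*} [Fintype ι] [DecidableEq ι] [AddCommGroup V]
    [Module ℝ V] [TopologicalSpace V] [IsTopologicalAddGroup V] [ContinuousSMul ℝ V]
    [AddCommGroup E] [Module ℝ E] (B : V →ₗ[ℝ] V →ₗ[ℝ] E)

/-- A unit with vanishing coefficient can be used to add any rank-one term. -/
theorem exists_joinedIn_add_rankOne_of_coeff_eq_zero {K : Set E} (hK : Convex ℝ K)
    (W : (ι → ℝ) × (ι → V)) {i : ι} (hi : W.1 i = 0) (v : V) (c : ℝ)
    (hW : rankOneSum B W ∈ K) (hv : rankOneSum B W + c • B v v ∈ K) :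
    ∃ W', JoinedIn (rankOneSum B ⁻¹' K) W W' ∧ rankOneSum B W' = rankOneSum B W + c • B v v := by
  obtain ⟨α, u⟩ := W
  simp only at hi
  have hα : Function.update α i 0 = α := by rw [← hi, Function.update_eq_self]
  have h1 : ∀ x, rankOneSum B (α, Function.update u i x) = rankOneSum B (α, u) := by
    intro x
    have := rankOneSum_update B α u i 0 x
    rw [hα] at this
    simpa [hi] using this
  have h2 : ∀ a, rankOneSum B (Function.update α i a, Function.update u i v) =
      rankOneSum B (α, u) + a • B v v := by
    intro a
    simpa [hi] using rankOneSum_update B α u i a v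
  refine ⟨(Function.update α i c, Function.update u i v), ?_, h2 c⟩
  refine JoinedIn.trans (y := (α, Function.update u i v)) ?_ ?_
  · refine JoinedIn.ofLine
      (f := fun s => (α, Function.update u i (u i + s • (v - u i)))) ?_ ?_ ?_ ?_
    · exact Continuous.continuousOn <| continuous_const.prodMk <|
        continuous_const.update i (by fun_prop)
    · simp
    · simp
    · rintro _ ⟨s, -, rfl⟩
      simpa only [mem_preimage, h1] using hW
  · refine JoinedIn.ofLine
      (f := fun s => (Function.update α i (s * c), Function.update u i v)) ?_ ?_ ?_ ?_
    · exact Continuous.continuousOn <| Continuous.prodMk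
        (continuous_const.update i (by fun_prop)) continuous_const
    · simp [hα]
    · simp
    · rintro _ ⟨s, hs, rfl⟩
      simp only [mem_preimage, h2, mul_smul]
      exact hK.add_smul_mem_of_mem_Icc hW hv hs

/-- If the vectors are dependent, one can move inside the fiber to a vanishing coefficient. -/
theorem exists_joinedIn_fiber_coeff_eq_zero (hB : ∀ x y, B x y = B y x)
    (W : (ι → ℝ) × (ι → V)) (hW : ¬ LinearIndependent ℝ W.2) :
    ∃ W', JoinedIn (rankOneSum B ⁻¹' {rankOneSum B W}) W W' ∧ ∃ i, W'.1 i = 0 := by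
  by_cases h0 : ∃ i, W.1 i = 0
  · exact ⟨W, JoinedIn.refl rfl, h0⟩
  push Not at h0
  obtain ⟨d, w⟩ := W
  simp only at h0 hW
  obtain ⟨g, hg, i, hi⟩ := Fintype.not_linearIndependent_iff.1 hW
  set S := Finset.univ.erase i with hS
  have hwi : ∑ j ∈ S, (-(g j / g i)) • w j = w i := by
    rw [← Finset.add_sum_erase _ _ (Finset.mem_univ i)] at hg
    have : ∑ j ∈ S, (-(g j / g i)) • w j = -(g i)⁻¹ • ∑ j ∈ S, g j • w j := by
      rw [Finset.smul_sum]
      refine Finset.sum_congr rfl fun j _ => ?_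
      rw [smul_smul]; congr 1; ring
    rw [this, ← neg_eq_iff_add_eq_zero.2 hg, smul_neg, smul_smul, neg_mul, inv_mul_cancel₀ hi]
    simp
  -- The term `d i • B (w i) (w i)` is gradually transferred to the other units, whose span contains
  -- `w i`. Either it is used up (`θ = 1`) or another coefficient vanishes first.
  obtain ⟨θ, hθ, α, u, hα, hu, hα0, hu0, hαu, hz⟩ := exists_unitInterval_rankOne_update B hB w d
    (fun j => -(g j / g i)) S (fun j _ => h0 j) (d i)
  rw [hwi] at hαu
  have hiS : i ∉ S := Finset.notMem_erase i _
  refine ⟨(Function.update (α 1) i (d i - 1 * θ * d i), u 1), ?_, ?_⟩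
  · refine JoinedIn.ofLine
      (f := fun s => (Function.update (α s) i (d i - s * θ * d i), u s)) ?_ ?_ rfl ?_
    · refine ContinuousOn.prodMk (fun s hs => (hα s hs).update i ?_) hu
      exact (by fun_prop : Continuous fun s => d i - s * θ * d i).continuousWithinAt
    · simp [hα0, hu0]
    · rintro _ ⟨s, hs, rfl⟩
      obtain ⟨h1, h2⟩ := hαu s hs
      have h3 := rankOneSum_update B (α s) (u s) i (d i - s * θ * d i) (u s i)
      rw [Function.update_eq_self] at h3
      rw [mem_preimage, mem_singleton_iff, h3]
      unfold rankOneSum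
      simp only
      rw [← Finset.add_sum_erase _ _ (Finset.mem_univ i), h2,
        ← Finset.add_sum_erase _ (fun j => d j • B (w j) (w j)) (Finset.mem_univ i),
        (h1 i hiS).1, (h1 i hiS).2]
      module
  · rcases hz with rfl | ⟨j, hj, h⟩
    · exact ⟨i, by simp⟩
    · exact ⟨j, by simpa [Function.update_of_ne (Finset.ne_of_mem_erase hj)] using h⟩

/-- With at least `dim V` units, rank-one segments in a convex set lift to paths from any point of
the fiber. -/
theorem exists_joinedIn_add_rankOne [FiniteDimensional ℝ V]
    (hcard : Module.finrank ℝ V ≤ Fintype.card ι) (hB : ∀ x y, B x y = B y x) {K : Set E}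
    (hK : Convex ℝ K) (W : (ι → ℝ) × (ι → V)) (v : V) (c : ℝ)
    (hW : rankOneSum B W ∈ K) (hv : rankOneSum B W + c • B v v ∈ K) :
    ∃ W', JoinedIn (rankOneSum B ⁻¹' K) W W' ∧ rankOneSum B W' = rankOneSum B W + c • B v v := by
  by_cases h0 : ∃ i, W.1 i = 0
  · obtain ⟨i, hi⟩ := h0
    exact exists_joinedIn_add_rankOne_of_coeff_eq_zero B hK W hi v c hW hv
  push Not at h0
  by_cases hli : LinearIndependent ℝ W.2
  · obtain ⟨d, w⟩ := W
    simp only at h0 hli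
    have hspan := hli.span_eq_top_of_card_eq_finrank'
      (le_antisymm hli.fintype_card_le_finrank hcard)
    obtain ⟨b, rfl⟩ : ∃ b : ι → ℝ, ∑ j, b j • w j = v :=
      (Submodule.mem_span_range_iff_exists_fun ℝ).1 (hspan ▸ Submodule.mem_top)
    set v := ∑ j, b j • w j
    obtain ⟨θ, hθ, α, u, hα, hu, hα0, hu0, hαu, hz⟩ := exists_unitInterval_rankOne_update B hB w d
      b Finset.univ (fun j _ => h0 j) c
    have hsum : ∀ s ∈ Icc (0 : ℝ) 1, rankOneSum B (α s, u s) =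
        rankOneSum B (d, w) + (s * θ) • c • B v v := by
      intro s hs
      rw [smul_smul]
      exact (hαu s hs).2
    have hmem : ∀ s ∈ Icc (0 : ℝ) 1, rankOneSum B (α s, u s) ∈ K := by
      intro s hs
      rw [hsum s hs]
      exact hK.add_smul_mem_of_mem_Icc hW hv
        ⟨mul_nonneg hs.1 hθ.1, mul_le_one₀ hs.2 hθ.1 hθ.2⟩
    have hjoin : JoinedIn (rankOneSum B ⁻¹' K) (d, w) (α 1, u 1) := by
      refine JoinedIn.ofLine (f := fun s => (α s, u s)) (hα.prodMk hu) (by simp [hα0, hu0]) rfl ?_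
      rintro _ ⟨s, hs, rfl⟩
      exact hmem s hs
    have h1 := hsum 1 (by simp)
    rcases hz with rfl | ⟨j, -, hj⟩
    · exact ⟨_, hjoin, by simpa using h1⟩
    -- The unit whose coefficient has vanished supplies the remaining part of the segment.
    · have h2 : rankOneSum B (α 1, u 1) + ((1 - θ) * c) • B v v =
          rankOneSum B (d, w) + c • B v v := by
        rw [h1]; module
      obtain ⟨W', hW', hW'2⟩ := exists_joinedIn_add_rankOne_of_coeff_eq_zero B hK (α 1, u 1)
        (i := j) hj v ((1 - θ) * c) (hmem 1 (by simp)) (h2 ▸ hv)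
      exact ⟨W', hjoin.trans hW', hW'2.trans h2⟩
  · obtain ⟨W₁, hj, i, hi⟩ := exists_joinedIn_fiber_coeff_eq_zero B hB W hli
    have h1 : rankOneSum B W₁ = rankOneSum B W := hj.target_mem
    obtain ⟨W', hW', hW'2⟩ := exists_joinedIn_add_rankOne_of_coeff_eq_zero B hK W₁ hi v c
      (h1 ▸ hW) (h1 ▸ hv)
    refine ⟨W', JoinedIn.trans (hj.mono ?_) hW', by rw [hW'2, h1]⟩
    exact preimage_mono (singleton_subset_iff.2 hW)

end Lift

/-! ### Chains of directed moves in convex sublevel sets -/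

/-- A move inside `K` along a direction of `R`. -/
def DirectedStep {E : Type*} [AddCommGroup E] [Module ℝ E] (R K : Set E) (x y : E) : Prop :=
  x ∈ K ∧ y ∈ K ∧ ∃ c : ℝ, ∃ e ∈ R, y = x + c • e

theorem DirectedStep.mono {E : Type*} [AddCommGroup E] [Module ℝ E] {R K K' : Set E} (h : K ⊆ K')
    {x y : E} (hxy : DirectedStep R K x y) : DirectedStep R K' x y :=
  ⟨h hxy.1, h hxy.2.1, hxy.2.2⟩

theorem DirectedStep.symm {E : Type*} [AddCommGroup E] [Module ℝ E] {R K : Set E}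
    {x y : E} (hxy : DirectedStep R K x y) : DirectedStep R K y x := by
  obtain ⟨hx, hy, c, e, he, rfl⟩ := hxy
  exact ⟨hy, hx, -c, e, he, by simp⟩

section

variable {E : Type*} [NormedAddCommGroup E] [NormedSpace ℝ E]

/-- By connectedness the claim is local. Near `x`, one changes the coordinates in a basis taken from
`R` one at a time; the finitely many intermediate points depend continuously on the endpoint, hence
stay in `U`. -/
theorem reflTransGen_directedStep_of_isOpen [FiniteDimensional ℝ E] {R U : Set E}
    (hR : Submodule.span ℝ R = ⊤) (hU : IsOpen U) (hUc : IsPreconnected U) {x y : E}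
    (hx : x ∈ U) (hy : y ∈ U) : Relation.ReflTransGen (DirectedStep R U) x y := by
  have hs : Std.Symm (DirectedStep R U) := ⟨fun _ _ h => h.symm⟩
  refine hUc.induction₂ (Relation.ReflTransGen (DirectedStep R U)) (fun x hx => ?_)
    (fun _ _ _ _ _ _ h h' => h.trans h') (fun _ _ _ _ h => symm h) hx hy
  apply Filter.Eventually.filter_mono nhdsWithin_le_nhds
  set b := Module.Basis.ofSpan hR.ge
  have hb : ∀ i, b i ∈ R := fun i => Module.Basis.ofSpan_subset hR.ge (mem_range_self i)
  have : Fintype _ := FiniteDimensional.fintypeBasisIndex b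
  have hev : ∀ T : Finset _, ∀ᶠ y in 𝓝 x, x + ∑ i ∈ T, b.repr (y - x) i • b i ∈ U := by
    intro T
    have hcont : Continuous fun y => x + ∑ i ∈ T, b.repr (y - x) i • b i := by
      refine continuous_const.add (continuous_finsetSum _ fun i _ => Continuous.smul ?_
        continuous_const)
      exact (b.coord i).continuous_of_finiteDimensional.comp (by fun_prop)
    refine hcont.continuousAt.eventually_mem (hU.mem_nhds ?_)
    simpa using hx
  filter_upwards [eventually_all.2 hev] with y hy
  have key : ∀ T : Finset _, Relation.ReflTransGen (DirectedStep R U) x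
      (x + ∑ i ∈ T, b.repr (y - x) i • b i) := by
    classical
    intro T
    induction T using Finset.induction_on with
    | empty => simpa using Relation.ReflTransGen.refl
    | insert i T hi ih =>
      refine ih.tail ⟨hy T, hy _, b.repr (y - x) i, b i, hb i, ?_⟩
      rw [Finset.sum_insert hi]
      abel
  have := key Finset.univ
  rwa [b.sum_repr, add_sub_cancel] at this

/-- At a point which is not a minimum, some direction of a spanning set changes `f` to a smaller
value. -/
theorem ConvexOn.exists_directedStep_lt {R : Set E} (hR : Submodule.span ℝ R = ⊤) {f : E → ℝ}
    (hf : ConvexOn ℝ univ f) {x y : E} (hfx : DifferentiableAt ℝ f x) (hxy : f y < f x) :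
    ∃ c : ℝ, ∃ e ∈ R, f (x + c • e) < f x := by
  by_contra! h
  -- If `x` minimizes `f` along every direction of `R`, the derivative vanishes on the span of `R`,
  -- so everywhere, and convexity makes `x` a global minimum.
  have h0 : ∀ e ∈ R, fderiv ℝ f x e = 0 := by
    intro e he
    have hline : HasDerivAt (fun c : ℝ => f (x + c • e)) (fderiv ℝ f x e) 0 :=
      hfx.hasFDerivAt.hasLineDerivAt e
    refine IsLocalMin.hasDerivAt_eq_zero (Eventually.of_forall fun c => ?_) hline
    simpa using h c e he
  have hzero : fderiv ℝ f x (y - x) = 0 := by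
    have : (⊤ : Submodule ℝ E) ≤ LinearMap.ker (fderiv ℝ f x : E →ₗ[ℝ] ℝ) := by
      rw [← hR, Submodule.span_le]
      exact h0
    exact this (x := y - x) Submodule.mem_top
  have hline : HasDerivAt (fun c : ℝ => f (x + c • (y - x))) 0 0 := by
    have h := hfx.hasFDerivAt.hasLineDerivAt (y - x)
    rwa [hzero] at h
  have hconv : ConvexOn ℝ univ (fun c : ℝ => f (x + c • (y - x))) := by
    have := hf.comp_affineMap (AffineMap.lineMap x y)
    rw [preimage_univ] at this
    refine this.congr fun c _ => ?_
    simp [AffineMap.lineMap_apply, add_comm]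
  have := hconv.le_slope_of_hasDerivAt (mem_univ 0) (mem_univ 1) one_pos hline
  simp [slope_def_field] at this
  linarith

/-- The strict sublevel set is open and convex, so chains exist there; a point at level exactly `t`
is not a minimum and enters it by one move. -/
theorem ConvexOn.reflTransGen_directedStep_sublevel [FiniteDimensional ℝ E] {R : Set E}
    (hR : Submodule.span ℝ R = ⊤) {f : E → ℝ} (hf : ConvexOn ℝ univ f) (hfd : Differentiable ℝ f)
    {t : ℝ} (ht : ∃ z, f z < t) {x y : E} (hx : f x ≤ t) (hy : f y ≤ t) :
    Relation.ReflTransGen (DirectedStep R {z | f z ≤ t}) x y := by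
  have hs : Std.Symm (DirectedStep R {z | f z ≤ t}) := ⟨fun _ _ h => h.symm⟩
  obtain ⟨z, hz⟩ := ht
  have hU : IsOpen {z | f z < t} := isOpen_lt hfd.continuous continuous_const
  have hUc : IsPreconnected {z | f z < t} := by
    simpa using (hf.convex_lt t).isPreconnected
  have hto : ∀ x, f x ≤ t → ∃ x', f x' < t ∧
      Relation.ReflTransGen (DirectedStep R {z | f z ≤ t}) x x' := by
    intro x hx
    rcases hx.lt_or_eq with h | h
    · exact ⟨x, h, .refl⟩
    · obtain ⟨c, e, he, hlt⟩ := hf.exists_directedStep_lt hR (hfd x) (h ▸ hz)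
      rw [h] at hlt
      exact ⟨_, hlt, .single ⟨hx, hlt.le, c, e, he, rfl⟩⟩
  obtain ⟨x', hx', hxx'⟩ := hto x hx
  obtain ⟨y', hy', hyy'⟩ := hto y hy
  refine hxx'.trans (.trans ?_ (symm hyy'))
  have hle : {z | f z < t} ⊆ {z | f z ≤ t} := fun z (hz : f z < t) => hz.le
  have hchain := reflTransGen_directedStep_of_isOpen hR hU hUc hx' hy'
  exact Relation.ReflTransGen.mono (fun _ _ h => DirectedStep.mono hle h) _ _ hchain

theorem hasNoSpuriousValleys_comp_rankOneSum [FiniteDimensional ℝ E] {ι V : Type*} [Fintype ι]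
    [AddCommGroup V] [Module ℝ V] [FiniteDimensional ℝ V] [TopologicalSpace V]
    [IsTopologicalAddGroup V] [ContinuousSMul ℝ V]
    (hcard : Module.finrank ℝ V ≤ Fintype.card ι) (B : V →ₗ[ℝ] V →ₗ[ℝ] E)
    (hB : ∀ x y, B x y = B y x) (hBc : Continuous fun v => B v v)
    (hspan : Submodule.span ℝ (range fun v => B v v) = ⊤) {f : E → ℝ} (hf : ConvexOn ℝ univ f)
    (hfd : Differentiable ℝ f) :
    HasNoSpuriousValleys fun W : (ι → ℝ) × (ι → V) => f (rankOneSum B W) := by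
  classical
  refine ⟨?_, fun t => ⟨f '' {z | f z ≤ t}, ?_, fun W hW => ?_⟩⟩
  · refine hfd.continuous.comp (continuous_finsetSum _ fun i _ => Continuous.smul ?_ ?_)
    · fun_prop
    · exact hBc.comp (by fun_prop)
  · refine IsPreconnected.ordConnected ?_
    refine IsPreconnected.image ?_ f hfd.continuous.continuousOn
    simpa using (hf.convex_le t).isPreconnected
  apply Subset.antisymm
  · rintro _ ⟨W', hW', rfl⟩
    have h := connectedComponentIn_subset _ _ hW'
    exact ⟨rankOneSum B W', h, rfl⟩
  rintro _ ⟨y, hy, rfl⟩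
  by_cases ht : ∃ z, f z < t
  · have hK : Convex ℝ {z | f z ≤ t} := by simpa using hf.convex_le t
    have hlift : ∀ y, Relation.ReflTransGen (DirectedStep (range fun v => B v v) {z | f z ≤ t})
        (rankOneSum B W) y →
        ∃ W', JoinedIn (rankOneSum B ⁻¹' {z | f z ≤ t}) W W' ∧ rankOneSum B W' = y := by
      intro y h
      induction h with
      | refl => exact ⟨W, JoinedIn.refl hW, rfl⟩
      | tail _ h ih =>
        obtain ⟨W₁, hj, rfl⟩ := ih
        obtain ⟨h1, h2, c, _, ⟨v, rfl⟩, rfl⟩ := h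
        obtain ⟨W', hj', h⟩ := exists_joinedIn_add_rankOne B hcard hB hK W₁ v c h1 h2
        exact ⟨W', hj.trans hj', h⟩
    obtain ⟨W', hj, rfl⟩ := hlift y (hf.reflTransGen_directedStep_sublevel hspan hfd ht hW hy)
    refine ⟨W', ?_, rfl⟩
    obtain ⟨γ, hγ⟩ := hj
    refine (isPreconnected_range γ.continuous).subset_connectedComponentIn ⟨0, γ.source⟩ ?_
      ⟨1, γ.target⟩
    rintro _ ⟨s, rfl⟩
    exact hγ s
  -- Here `t` is a lower bound of `f`, so `f` equals `t` on the whole sublevel set.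
  · push Not at ht
    refine ⟨W, mem_connectedComponentIn hW, ?_⟩
    exact (le_antisymm hW (ht _)).trans (le_antisymm hy (ht _)).symm

end

/-! ### Symmetric matrices and conclusion -/

/-- The symmetric product `(x yᵀ + y xᵀ) / 2`. -/
noncomputable def symmetricProduct (n : ℕ) : (Fin n → ℝ) →ₗ[ℝ] (Fin n → ℝ) →ₗ[ℝ] SymSquare n :=
  LinearMap.mk₂ ℝ
    (fun x y => ⟨(2⁻¹ : ℝ) • (Matrix.vecMulVec x y + Matrix.vecMulVec y x), by
      ext i j
      simp only [Matrix.transpose_apply, Matrix.smul_apply, Matrix.add_apply,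
        Matrix.vecMulVec_apply, smul_eq_mul]
      ring⟩)
    (fun x x' y => by
      ext i j
      simp [Matrix.vecMulVec_apply]
      ring)
    (fun c x y => by
      ext i j
      simp [Matrix.vecMulVec_apply]
      ring)
    (fun x y y' => by
      ext i j
      simp [Matrix.vecMulVec_apply]
      ring)
    (fun c x y => by
      ext i j
      simp [Matrix.vecMulVec_apply]
      ring)

theorem coe_symmetricProduct_apply {n : ℕ} (x y : Fin n → ℝ) (i j : Fin n) :
    (symmetricProduct n x y : Matrix (Fin n) (Fin n) ℝ) i j = 2⁻¹ * (x i * y j + y i * x j) := by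
  simp [symmetricProduct, Matrix.vecMulVec_apply, mul_add]

theorem symmetricProduct_comm {n : ℕ} (x y : Fin n → ℝ) :
    symmetricProduct n x y = symmetricProduct n y x := by
  ext i j
  simp only [coe_symmetricProduct_apply]
  ring

theorem symmetricProduct_self {n : ℕ} (x : Fin n → ℝ) :
    symmetricProduct n x x = tensorSquare x := by
  ext i j
  simp only [coe_symmetricProduct_apply, tensorSquare, Matrix.vecMulVec_apply]
  ring

/-- Polarization. -/
theorem symmetricProduct_mem_span {n : ℕ} (x y : Fin n → ℝ) :
    symmetricProduct n x y ∈ Submodule.span ℝ (range fun v => symmetricProduct n v v) := by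
  have h : symmetricProduct n x y = (2⁻¹ : ℝ) • (symmetricProduct n (x + y) (x + y) -
      symmetricProduct n x x - symmetricProduct n y y) := by
    simp only [map_add, LinearMap.add_apply, symmetricProduct_comm y x]
    module
  rw [h]
  exact Submodule.smul_mem _ _ (sub_mem (sub_mem (Submodule.subset_span ⟨_, rfl⟩)
    (Submodule.subset_span ⟨_, rfl⟩)) (Submodule.subset_span ⟨_, rfl⟩))

theorem span_symmetricProduct_self (n : ℕ) :
    Submodule.span ℝ (range fun v => symmetricProduct n v v) = ⊤ := by
  refine Submodule.eq_top_iff'.2 fun A => ?_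
  have hA : A = ∑ i, ∑ j, (A : Matrix (Fin n) (Fin n) ℝ) i j •
      symmetricProduct n (Pi.single i 1) (Pi.single j 1) := by
    ext k l
    have hsymm : (A : Matrix (Fin n) (Fin n) ℝ) l k = (A : Matrix (Fin n) (Fin n) ℝ) k l :=
      A.2.apply k l
    simp only [AddSubmonoidClass.coe_finsetSum, Submodule.coe_smul, Matrix.sum_apply,
      Matrix.smul_apply, coe_symmetricProduct_apply, smul_eq_mul, Pi.single_apply, mul_add,
      Finset.sum_add_distrib]
    simp [hsymm]
    ring
  rw [hA]
  exact sum_mem fun i _ => sum_mem fun j _ => Submodule.smul_mem _ _ (symmetricProduct_mem_span _ _)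

theorem continuous_symmetricProduct_self (n : ℕ) :
    Continuous fun v => symmetricProduct n v v := by
  have h := (symmetricProduct n).toContinuousBilinearMap.continuous₂
  exact h.comp (continuous_id.prodMk continuous_id)

theorem theorem2p7 (n r : ℕ) (hr : n ≤ r) (ℓ : SymSquare n → ℝ)
    (hsmooth : ContDiff ℝ ∞ ℓ) (hconvex : ConvexOn ℝ Set.univ ℓ) :
    HasNoSpuriousValleys (fun W : NetworkWeights r n => ℓ (quadraticNetworkMap r n W)) := by
  have h := hasNoSpuriousValleys_comp_rankOneSum (ι := Fin r) (by simpa using hr)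
    (symmetricProduct n) symmetricProduct_comm (continuous_symmetricProduct_self n)
    (span_symmetricProduct_self n) hconvex (hsmooth.differentiable (by simp))
  simpa only [rankOneSum, quadraticNetworkMap, symmetricProduct_self] using h
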